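/- Let $d\in\mathbb N$ and $p,q\in[1,\infty]$. For a measurable function $m:\mathbb R^{2d}\to(0,\infty)$ let $L^{p,q}_m(\mathbb R^{2d})$ be the space of (a.e. classes of) measurable functions $f:\mathbb R^d\times\mathbb R^d\to\mathbb C$ with $$\|f\|_{p,q,m}=\big\|\,\omega\mapsto\|f(\cdot,\omega)\,m(\cdot,\omega)\|_{L^p(\mathbb R^d)}\big\|_{L^q(\mathbb R^d)}<\infty ,$$ and write $L^{p,q}=L^{p,q}_1$. Call a measurable $m:\mathbb R^{2d}\to(0,\infty)$ a moderate weight if it is even, $m(-z)=m(z)$, and there are $N>0$ and $C>0$ with $m(z+w)\le C(1+\|z\|)^N m(w)$ for all $z,w\in\mathbb R^{2d}$. Let $m$ be a moderate weight and let $S\in\mathrm{Sp}(2d,\mathbb R)$ be a symplectic matrix. Assume $m\asymp m\circ S^{-1}$, i.e. there are constants $A,B>0$ with $A\,m(S^{-1}z)\le m(z)\le B\,m(S^{-1}z)$ for all $z\in\mathbb R^{2d}$. Then the operator $$\mathcal D_S:L^{p,q}\to L^{p,q},\qquad f\mapsto f\circ S^{-1},$$ is (everywhere defined and) bounded if and only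 if the operator $$(\mathcal D_S)_m:L^{p,q}_m\to L^{p,q}_m,\qquad f\mapsto f\circ S^{-1},$$ is (everywhere defined and) bounded. -/

import Mathlib

open MeasureTheory
open scoped ENNReal NNReal

/-- Phase space `ℝ^{2d} = ℝ^d × ℝ^d` with the Euclidean norm and Lebesgue measure;
the coordinates `Sum.inl i` are those of `x`, the coordinates `Sum.inr i` those of `ω`. -/
abbrev PhaseSpace (d : ℕ) : Type := EuclideanSpace ℝ (Fin d ⊕ Fin d)

/-- The point `(x, ω)` of phase space. -/
def phasePoint {d : ℕ} (x ω : EuclideanSpace ℝ (Fin d)) : PhaseSpace d :=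
  WithLp.toLp 2 (Sum.elim (fun i => x i) (fun i => ω i))

/-- The weighted mixed norm `‖f‖_{p,q,m} = ‖ ω ↦ ‖f(·, ω) m(·, ω)‖_p ‖_q`, with values in
`[0, ∞]`. -/
noncomputable def mixedNorm {d : ℕ} (p q : ℝ≥0∞) (m : PhaseSpace d → ℝ)
    (f : PhaseSpace d → ℂ) : ℝ≥0∞ :=
  eLpNorm (fun ω : EuclideanSpace ℝ (Fin d) =>
    eLpNorm (fun x : EuclideanSpace ℝ (Fin d) =>
      f (phasePoint x ω) * (m (phasePoint x ω) : ℂ)) p volume) q volume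

/-- Membership in the weighted mixed-norm space `L^{p,q}_m(ℝ^{2d})`: (Lebesgue) measurable
functions with finite mixed norm. -/
def MemLpq {d : ℕ} (p q : ℝ≥0∞) (m : PhaseSpace d → ℝ) (f : PhaseSpace d → ℂ) : Prop :=
  AEStronglyMeasurable f volume ∧ mixedNorm p q m f < ∞

/-- Moderate weights: positive even (Lebesgue) measurable functions on `ℝ^{2d}` that are
`v`-moderate for some polynomial weight `v(z) = (1 + ‖z‖)^N`, `N > 0`. -/
structure IsModerateWeight {d : ℕ} (m : PhaseSpace d → ℝ) : Prop where
  pos : ∀ z, 0 < m z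
  even : ∀ z, m (-z) = m z
  aemeasurable : AEMeasurable m volume
  moderate : ∃ N : ℝ, 0 < N ∧ ∃ C : ℝ, 0 < C ∧
    ∀ z w, m (z + w) ≤ C * (1 + ‖z‖) ^ N * m w

/-- The action `z ↦ S⁻¹ z` of the inverse of a matrix on phase space. -/
noncomputable def invAct {d : ℕ} (S : Matrix (Fin d ⊕ Fin d) (Fin d ⊕ Fin d) ℝ)
    (z : PhaseSpace d) : PhaseSpace d :=
  Matrix.toEuclideanLin S⁻¹ z

/-- The dilation operator `D_S f = f ∘ S⁻¹`, on all functions on phase space. -/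
noncomputable def dilation {d : ℕ} (S : Matrix (Fin d ⊕ Fin d) (Fin d ⊕ Fin d) ℝ) :
    (PhaseSpace d → ℂ) →ₗ[ℂ] (PhaseSpace d → ℂ) :=
  LinearMap.funLeft ℂ ℂ (invAct S)

/-- An operator is a bounded operator `L^{p,q}_m → L^{p,q}_m`: it is defined on all of
`L^{p,q}_m`, maps it into itself, and satisfies a norm bound there. -/
def IsBoundedOnLpq {d : ℕ} (p q : ℝ≥0∞) (m : PhaseSpace d → ℝ)
    (T : (PhaseSpace d → ℂ) →ₗ[ℂ] (PhaseSpace d → ℂ)) : Prop :=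
  ∃ C : ℝ≥0, ∀ f : PhaseSpace d → ℂ, MemLpq p q m f →
    MemLpq p q m (T f) ∧ mixedNorm p q m (T f) ≤ C * mixedNorm p q m f

/-- `u ≍ w` for functions on phase space: each is bounded by a constant multiple of the other. -/
def WeightEquiv {d : ℕ} (u w : PhaseSpace d → ℝ) : Prop :=
  ∃ A B : ℝ, 0 < A ∧ 0 < B ∧ ∀ z, A * w z ≤ u z ∧ u z ≤ B * w z

/-! Multiplication by `w / u` is an isometry from the `w`-weighted space onto the `u`-weighted one.
Conjugating the dilation by it only multiplies by the quotient of `w / u` and `(w / u) ∘ S⁻¹`, which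
`hK` bounds by `K`. `IsBoundedOnLpq.dilation_change_weight` thus gives both directions, with `(u,
w)` equal to `(1, m)` and `(m, 1)`. -/

/-- A pointwise domination of the weighted functions dominates the mixed norms. -/
theorem mixedNorm_le_mul_of_le {d : ℕ} (p q : ℝ≥0∞) {u w : PhaseSpace d → ℝ}
    {f g : PhaseSpace d → ℂ} (K : ℝ≥0)
    (h : ∀ z, ‖f z * (w z : ℂ)‖ ≤ K * ‖g z * (u z : ℂ)‖) :
    mixedNorm p q w f ≤ K * mixedNorm p q u g := by
  refine eLpNorm_le_nnreal_smul_eLpNorm_of_ae_le_mul' (ae_of_all _ fun ω => ?_) q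
  refine eLpNorm_le_nnreal_smul_eLpNorm_of_ae_le_mul (ae_of_all _ fun x => ?_) p
  exact h _

/-- Keeps `f ∘ S⁻¹` a.e. measurable when `f` is only a.e. measurable: an invertible linear map pulls
null sets back to null sets. -/
theorem quasiMeasurePreserving_invAct {d : ℕ} {S : Matrix (Fin d ⊕ Fin d) (Fin d ⊕ Fin d) ℝ}
    (hS : IsUnit S.det) :
    Measure.QuasiMeasurePreserving (invAct S) (volume : Measure (PhaseSpace d)) volume := by
  have hdet : LinearMap.det (Matrix.toEuclideanLin S⁻¹) ≠ 0 := by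
    rw [Matrix.toEuclideanLin_eq_toLin_orthonormal, LinearMap.det_toLin]
    exact (Matrix.isUnit_nonsing_inv_det S hS).ne_zero
  exact Measure.LinearMap.quasiMeasurePreserving volume _ hdet

/-- Boundedness of the dilation passes from one weighted mixed-norm space to another when the
quotient of the weights is, up to a constant, not increased by the dilation. -/
theorem IsBoundedOnLpq.dilation_change_weight {d : ℕ} {p q : ℝ≥0∞} {u w : PhaseSpace d → ℝ}
    {S : Matrix (Fin d ⊕ Fin d) (Fin d ⊕ Fin d) ℝ} (hS : IsUnit S.det)
    (hu : AEMeasurable u volume) (hw : AEMeasurable w volume)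
    (hu_pos : ∀ z, 0 < u z) (hw_pos : ∀ z, 0 < w z) (K : ℝ≥0)
    (hK : ∀ z, w z * u (invAct S z) ≤ K * (u z * w (invAct S z)))
    (h : IsBoundedOnLpq p q u (dilation S)) : IsBoundedOnLpq p q w (dilation S) := by
  obtain ⟨C, hC⟩ := h
  refine ⟨K * C, fun f hf => ?_⟩
  -- Chosen so that `g * u = f * w`.
  set g : PhaseSpace d → ℂ := fun z => f z * ((w z / u z : ℝ) : ℂ) with hg
  have hnorm : mixedNorm p q u g = mixedNorm p q w f := by
    have hgu : ∀ z, g z * (u z : ℂ) = f z * (w z : ℂ) := by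
      intro z
      simp only [hg]
      rw [mul_assoc, ← Complex.ofReal_mul, div_mul_cancel₀ _ (hu_pos z).ne']
    simp only [mixedNorm, hgu]
  have hgm : AEStronglyMeasurable g volume :=
    hf.1.mul (Complex.measurable_ofReal.comp_aemeasurable (hw.div hu)).aestronglyMeasurable
  obtain ⟨⟨-, hfin⟩, hle⟩ := hC g ⟨hgm, hnorm ▸ hf.2⟩
  have hdom : mixedNorm p q w (dilation S f) ≤ K * mixedNorm p q u (dilation S g) := by
    refine mixedNorm_le_mul_of_le p q K fun z => ?_
    have hw' := hw_pos (invAct S z)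
    have hu' := hu_pos (invAct S z)
    have hz : w z ≤ K * (w (invAct S z) / u (invAct S z) * u z) := by
      rw [← mul_le_mul_iff_of_pos_right hu']
      refine (hK z).trans_eq ?_
      field_simp
    simp only [dilation, LinearMap.funLeft_apply, hg, norm_mul, Complex.norm_real,
      Real.norm_of_nonneg (div_pos hw' hu').le, Real.norm_of_nonneg (hw_pos z).le,
      Real.norm_of_nonneg (hu_pos z).le]
    calc ‖f (invAct S z)‖ * w z
        ≤ ‖f (invAct S z)‖ * (K * (w (invAct S z) / u (invAct S z) * u z)) := by gcongr
      _ = _ := by ring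
  refine ⟨⟨hf.1.comp_quasiMeasurePreserving (quasiMeasurePreserving_invAct hS),
    hdom.trans_lt (ENNReal.mul_lt_top ENNReal.coe_lt_top hfin)⟩, hdom.trans ?_⟩
  rw [ENNReal.coe_mul, mul_assoc, ← hnorm]
  gcongr

/-- The unweighted space `L^{p,q}` is the space `L^{p,q}_m` with `m = 1`. -/
theorem mainTheorem5 (d : ℕ) (p q : ℝ≥0∞) (hp : 1 ≤ p) (hq : 1 ≤ q)
    (m : PhaseSpace d → ℝ) (hm : IsModerateWeight m)
    (S : Matrix (Fin d ⊕ Fin d) (Fin d ⊕ Fin d) ℝ)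
    (hS : S ∈ Matrix.symplecticGroup (Fin d) ℝ)
    (hequiv : WeightEquiv m (m ∘ invAct S)) :
    IsBoundedOnLpq p q (fun _ => 1) (dilation S) ↔ IsBoundedOnLpq p q m (dilation S) := by
  obtain ⟨A, B, hA, hB, hAB⟩ := hequiv
  have hdet := SymplecticGroup.symplectic_det hS
  constructor
  -- Here `hK` is the upper bound `m ≤ B * (m ∘ S⁻¹)`; in the converse it is `m ∘ S⁻¹ ≤ A⁻¹ * m`.
  · refine IsBoundedOnLpq.dilation_change_weight hdet aemeasurable_const hm.aemeasurable
      (fun _ => one_pos) hm.pos B.toNNReal fun z => ?_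
    simpa [hB.le] using (hAB z).2
  · refine IsBoundedOnLpq.dilation_change_weight hdet hm.aemeasurable aemeasurable_const
      hm.pos (fun _ => one_pos) A⁻¹.toNNReal fun z => ?_
    simpa [hA.le] using (le_inv_mul_iff₀ hA).2 (hAB z).1
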